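/- Let $k\ge 2$ be a fixed integer. A sequence $(m_n)_{n\ge 0}$ of real numbers is a Stieltjes moment sequence if there is a nonnegative Borel measure $\mu$ on $[0,\infty)$ with finite moments of all orders such that $m_n=\int_{[0,\infty)}x^n\,d\mu(x)$ for all $n\ge 0$; it is S-determinate if there is exactly one such measure $\mu$; and it is an infinitely divisible Stieltjes moment sequence if $(m_n^c)_{n\ge 0}$ is a Stieltjes moment sequence for every real $c>0$. Then: (a) the sequence $\left(\binom{(k+1)n}{n}\right)_{n\ge 0}$ is an infinitely divisible Stieltjes moment sequence; (b) for every real $c>0$, the power sequence $\left(\binom{(k+1)n}{n}^c\right)_{n\ge 0}$ is S-determinate; (c) for every real $c>0$, the measure $\mu_{k,c}$ on $[0,\infty)$ with moment sequence $\left(\binom{(k+1)n}{n}^c\right)_{n\ge 0}$ has the Mellin transform $$\int_{[0,\infty)}t^s\,d\mu_{k,c}(t)=\left(\frac{\Gamma((k+1)s+1)}{\Gamma(s+1)\,\Gamma(ks+1)}\right)^c\qquad\text{for all real } s\ge 0,$$ the integral being finite. -/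

import Mathlib

open MeasureTheory Set

namespace Stieltjes

/-- `μ` is a (nonnegative Borel) measure on `[0, ∞)`, viewed as a measure on `ℝ` that gives no mass
to the negative half-line, all of whose moments are finite, and `m` is its moment sequence. -/
def HasMoments (μ : Measure ℝ) (m : ℕ → ℝ) : Prop :=
  μ (Iio 0) = 0 ∧
    ∀ n : ℕ, IntegrableOn (fun x : ℝ => x ^ n) (Ici 0) μ ∧ ∫ x in Ici 0, x ^ n ∂μ = m n

/-- `m` is a Stieltjes moment sequence. -/
def IsMomentSeq (m : ℕ → ℝ) : Prop :=
  ∃ μ : Measure ℝ, HasMoments μ m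

/-- `m` is a Stieltjes determinate (S-det) moment sequence: exactly one measure on `[0, ∞)` has
`m` as its moment sequence. -/
def IsDet (m : ℕ → ℝ) : Prop :=
  ∃! μ : Measure ℝ, HasMoments μ m

/-- `m` is an infinitely divisible Stieltjes moment sequence: every positive real power of `m` is a
Stieltjes moment sequence. (The case `c = 1` says that `m` itself is one, so that `m n ≥ 0` for all
`n` and the real powers are the usual ones.) -/
def IsInfDivMomentSeq (m : ℕ → ℝ) : Prop :=
  ∀ c : ℝ, 0 < c → IsMomentSeq (fun n => m n ^ c)

end Stieltjes

/-! Let `C = (k+1)^(k+1) / k^k`. Euler's product turns the Gamma ratio divided by `C ^ s` into an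
infinite product of factors `((s+b)/(s+a)) * (a/b)` with `0 < a ≤ b`. The `c`-th power of each
factor is the Mellin transform of a probability measure on `[0, 1]` (`isMellin_ratio_rpow`). Such
transforms are closed under products and pointwise limits, so `c`-th powers survive to the full
product (`isMellin_Gamma_ratio_rpow`), and dilation by `C ^ c` restores the ratio. At integers the
ratio is the binomial coefficient. The moments grow at most geometrically, which forces bounded
support and hence uniqueness (`HasMoments.unique`); the Mellin formula thus passes to any measure
with these moments. -/

open Filter Topology

/-! ### Mellin transforms of probability measures on the unit interval -/

/-- `f` is, on `[0, ∞)`, the Mellin transform of a probability measure on `[0, 1]`. -/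
def IsMellin (f : ℝ → ℝ) : Prop :=
  ∃ μ : ProbabilityMeasure unitInterval, ∀ s : ℝ, 0 ≤ s →
    ∫ x, (x : ℝ) ^ s ∂(μ : Measure unitInterval) = f s

/-- The function `x ↦ x ^ s` on the unit interval, for `0 ≤ s`. -/
noncomputable def unitPow (s : ℝ) (hs : 0 ≤ s) : BoundedContinuousFunction unitInterval ℝ :=
  BoundedContinuousFunction.mkOfCompact
    ⟨fun x => (x : ℝ) ^ s, continuous_subtype_val.rpow_const fun _ => Or.inr hs⟩

theorem integrable_unitPow (μ : Measure unitInterval) [IsFiniteMeasure μ] {s : ℝ} (hs : 0 ≤ s) :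
    Integrable (fun x : unitInterval => (x : ℝ) ^ s) μ :=
  (unitPow s hs).integrable μ

theorem isMellin_one : IsMellin fun _ => 1 :=
  ⟨⟨Measure.dirac 1, inferInstance⟩, fun s _ => by simp⟩

/-- Multiplicative convolution, the law of a product of independent variables, multiplies Mellin
transforms. -/
theorem IsMellin.mul {f g : ℝ → ℝ} (hf : IsMellin f) (hg : IsMellin g) :
    IsMellin fun s => f s * g s := by
  obtain ⟨μ, hμ⟩ := hf
  obtain ⟨ν, hν⟩ := hg
  refine ⟨⟨(μ : Measure unitInterval).mconv (ν : Measure unitInterval), inferInstance⟩,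
    fun s hs => ?_⟩
  change ∫ x : unitInterval, (x : ℝ) ^ s ∂(μ : Measure unitInterval).mconv
    (ν : Measure unitInterval) = f s * g s
  rw [integral_mconv (integrable_unitPow _ hs), ← hμ s hs, ← hν s hs, ← integral_mul_const]
  refine integral_congr_ae (Eventually.of_forall fun x => ?_)
  simp only [← integral_const_mul]
  refine integral_congr_ae (Eventually.of_forall fun y => ?_)
  simp [Real.mul_rpow x.2.1 y.2.1]

theorem IsMellin.pow {f : ℝ → ℝ} (hf : IsMellin f) (n : ℕ) : IsMellin fun s => f s ^ n := by
  induction n with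
  | zero => simpa using isMellin_one
  | succ n ih => simpa only [pow_succ] using ih.mul hf

theorem IsMellin.prod {ι : Type*} (S : Finset ι) {f : ι → ℝ → ℝ} (hf : ∀ i ∈ S, IsMellin (f i)) :
    IsMellin fun s => ∏ i ∈ S, f i s := by
  classical
  induction S using Finset.induction_on with
  | empty => simpa using isMellin_one
  | insert i S hi ih =>
    simp only [Finset.prod_insert hi]
    exact (hf i (by simp)).mul (ih fun j hj => hf j (by simp [hj]))

/-- Probability measures on a compact space form a weakly compact space, and the transform at `s` is
weakly continuous, so any cluster point of the measures has transform `g`. -/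
theorem IsMellin.of_tendsto {f : ℕ → ℝ → ℝ} {g : ℝ → ℝ} (hf : ∀ n, IsMellin (f n))
    (h : ∀ s, 0 ≤ s → Tendsto (fun n => f n s) atTop (𝓝 (g s))) : IsMellin g := by
  choose μ hμ using hf
  obtain ⟨ν, -, hν⟩ := isCompact_univ.exists_mapClusterPt (f := atTop) (u := μ) (by simp)
  refine ⟨ν, fun s hs => ?_⟩
  have hc : Continuous fun κ : ProbabilityMeasure unitInterval =>
      ∫ x : unitInterval, (x : ℝ) ^ s ∂(κ : Measure unitInterval) :=
    continuous_iff_continuousAt.2 fun κ =>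
      ProbabilityMeasure.tendsto_iff_forall_integral_tendsto.1 tendsto_id (unitPow s hs)
  have h1 := hν.continuousAt_comp hc.continuousAt
  have h2 : Tendsto ((fun κ : ProbabilityMeasure unitInterval =>
      ∫ x : unitInterval, (x : ℝ) ^ s ∂(κ : Measure unitInterval)) ∘ μ) atTop (𝓝 (g s)) :=
    (h s hs).congr fun n => (hμ n s hs).symm
  exact eq_of_nhds_neBot (NeBot.mono h1 (inf_le_inf_left _ h2))

theorem IsMellin.convexComb {ι : Type*} (S : Finset ι) {w : ι → ℝ} {f : ι → ℝ → ℝ}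
    (hf : ∀ i ∈ S, IsMellin (f i)) (hw : ∀ i ∈ S, 0 ≤ w i) (h1 : ∑ i ∈ S, w i = 1) :
    IsMellin fun s => ∑ i ∈ S, w i * f i s := by
  have : ∀ i, ∃ μ : ProbabilityMeasure unitInterval, i ∈ S → ∀ s : ℝ, 0 ≤ s →
      ∫ x, (x : ℝ) ^ s ∂(μ : Measure unitInterval) = f i s := fun i => by
    by_cases hi : i ∈ S
    · exact (hf i hi).imp fun μ h _ => h
    · exact ⟨⟨Measure.dirac 1, inferInstance⟩, fun h => absurd h hi⟩
  choose μ hμ using this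
  refine ⟨⟨∑ i ∈ S, ENNReal.ofReal (w i) • (μ i : Measure unitInterval), ⟨?_⟩⟩, fun s hs => ?_⟩
  · simp [← ENNReal.ofReal_sum_of_nonneg hw, h1]
  · change ∫ x : unitInterval, (x : ℝ) ^ s
      ∂(∑ i ∈ S, ENNReal.ofReal (w i) • (μ i : Measure unitInterval)) = _
    rw [integral_finsetSum_measure
      fun i _ => (integrable_unitPow _ hs).smul_measure ENNReal.ofReal_ne_top]
    refine Finset.sum_congr rfl fun i hi => ?_
    rw [integral_smul_measure, hμ i hi s hs, ENNReal.toReal_ofReal (hw i hi), smul_eq_mul]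

/-- This is the law of `U ^ (1/b)` for `U` uniform. -/
theorem isMellin_div_add {b : ℝ} (hb : 0 < b) : IsMellin fun s => b / (s + b) := by
  let φ : unitInterval → unitInterval := fun x =>
    ⟨(x : ℝ) ^ b⁻¹, Real.rpow_nonneg x.2.1 _, Real.rpow_le_one x.2.1 x.2.2 (by positivity)⟩
  have hφ : Measurable φ := Measurable.subtype_mk (by fun_prop)
  refine ⟨⟨(volume : Measure unitInterval).map φ,
    Measure.isProbabilityMeasure_map hφ.aemeasurable⟩, fun s hs => ?_⟩
  change ∫ x : unitInterval, (x : ℝ) ^ s ∂(volume : Measure unitInterval).map φ = _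
  rw [integral_map hφ.aemeasurable (integrable_unitPow _ hs).1]
  have : ∀ x : unitInterval, (φ x : ℝ) ^ s = (x : ℝ) ^ (b⁻¹ * s) := fun x =>
    (Real.rpow_mul x.2.1 _ _).symm
  simp only [this]
  have h0 : 0 ≤ b⁻¹ * s := by positivity
  rw [show (volume : Measure unitInterval) = Measure.comap Subtype.val volume from rfl,
    integral_subtype_comap (s := unitInterval) measurableSet_Icc (fun x : ℝ => x ^ (b⁻¹ * s)), unitInterval,
    integral_Icc_eq_integral_Ioc, ← intervalIntegral.integral_of_le zero_le_one,
    integral_rpow (Or.inl (by linarith))]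
  rw [Real.one_rpow, Real.zero_rpow (by linarith), sub_zero]
  field_simp

/-- With `x = (b-a)/(s+b)`, the ratio `(s+b)/(s+a)` is `1/(1-x)`. The binomial series of
`(1-x)^(-c)` has nonnegative coefficients, and `x` is a multiple of the transform `b/(s+b)`: a
mixture of its powers results. -/
theorem isMellin_ratio_rpow {a b c : ℝ} (ha : 0 < a) (hab : a ≤ b) (hc : 0 < c) :
    IsMellin fun s => (((s + b) / (s + a)) * (a / b)) ^ c := by
  have hb : 0 < b := ha.trans_le hab
  let A : ℕ → ℝ := fun n => Ring.choose (c + n - 1) n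
  have hA : ∀ n, 0 ≤ A n := fun n => by
    -- `n! * A n` is the rising factorial of `c`, positive since `c > 0`.
    have h := Ring.factorial_nsmul_multichoose_eq_ascPochhammer c n
    rw [Polynomial.ascPochhammer_smeval_eq_eval, Ring.multichoose_eq, nsmul_eq_mul] at h
    have hp := ascPochhammer_pos n c hc
    rw [← h] at hp
    exact (pos_of_mul_pos_right hp (Nat.cast_nonneg _)).le
  have hA0 : A 0 = 1 := by simp [A]
  have hsum : ∀ x : ℝ, 0 ≤ x → x < 1 → HasSum (fun n => A n * x ^ n) (1 / (1 - x) ^ c) := by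
    intro x hx0 hx1
    have := (Real.one_div_one_sub_rpow_hasFPowerSeriesOnBall_zero c).hasSum (y := x)
      (by simpa [enorm_eq_nnnorm, ← NNReal.coe_lt_one, abs_of_nonneg hx0] using hx1)
    simpa [FormalMultilinearSeries.ofScalars_apply_eq, mul_comm] using this
  have hx : ∀ s, 0 ≤ s → 0 ≤ (b - a) / (s + b) ∧ (b - a) / (s + b) < 1 := fun s hs =>
    ⟨div_nonneg (by linarith) (by linarith), (div_lt_one (by linarith)).2 (by linarith)⟩
  have hval : ∀ s, 0 ≤ s → 1 / (1 - (b - a) / (s + b)) ^ c = ((s + b) / (s + a)) ^ c := by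
    intro s hs
    have h1 : 1 - (b - a) / (s + b) = ((s + b) / (s + a))⁻¹ := by
      have : s + b ≠ 0 := by positivity
      have : s + a ≠ 0 := by positivity
      field_simp
      ring
    rw [h1, Real.inv_rpow (by positivity), one_div, inv_inv]
  let W : ℕ → ℝ := fun N => ∑ n ∈ Finset.range (N + 1), A n * ((b - a) / b) ^ n
  have hd : 0 ≤ (b - a) / b := div_nonneg (by linarith) hb.le
  have hWpos : ∀ N, 0 < W N := fun N => by
    have : A 0 * ((b - a) / b) ^ 0 ≤ W N :=
      Finset.single_le_sum (f := fun n => A n * ((b - a) / b) ^ n)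
        (fun n _ => mul_nonneg (hA n) (pow_nonneg hd n)) (by simp)
    simp only [hA0, pow_zero, mul_one] at this
    linarith
  have hlim : ∀ s, 0 ≤ s → Tendsto (fun N => ∑ n ∈ Finset.range (N + 1),
      A n * ((b - a) / (s + b)) ^ n) atTop (𝓝 (((s + b) / (s + a)) ^ c)) := fun s hs => by
    have := (hsum _ (hx s hs).1 (hx s hs).2).tendsto_sum_nat.comp (tendsto_add_atTop_nat 1)
    rwa [hval s hs] at this
  have hlim0 : Tendsto W atTop (𝓝 ((b / a) ^ c)) := by simpa using hlim 0 le_rfl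
  -- Dividing the partial sums by their value `W N` at `s = 0` makes the weights sum to 1; the limit
  -- of `W N` supplies the factor `(a/b)^c`.
  refine IsMellin.of_tendsto (f := fun N s => ∑ n ∈ Finset.range (N + 1),
    (A n * ((b - a) / b) ^ n / W N) * (b / (s + b)) ^ n) (fun N => ?_) fun s hs => ?_
  · refine IsMellin.convexComb _ (fun n _ => (isMellin_div_add hb).pow n)
      (fun n _ => div_nonneg (mul_nonneg (hA n) (pow_nonneg hd n)) (hWpos N).le) ?_
    rw [← Finset.sum_div]
    exact div_self (hWpos N).ne'
  · have hpos : 0 < (b / a) ^ c := by positivity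
    have := (hlim s hs).div hlim0 hpos.ne'
    rw [← Real.div_rpow (by positivity) (by positivity)] at this
    rw [show (s + b) / (s + a) * (a / b) = (s + b) / (s + a) / (b / a) by
      rw [div_div_eq_mul_div, mul_div_assoc]]
    refine this.congr fun N => ?_
    simp only [Pi.div_apply]
    rw [Finset.sum_div]
    refine Finset.sum_congr rfl fun n _ => ?_
    have : (b - a) / (s + b) = (b - a) / b * (b / (s + b)) := by field_simp
    rw [this, mul_pow]
    ring

/-! ### Euler products for the Gamma ratio -/

theorem tendsto_rpow_mul_prod_Gamma_add_one {x : ℝ} (hx : 0 ≤ x) :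
    Tendsto (fun M : ℕ => (M : ℝ) ^ x * ∏ m ∈ Finset.range M, ((m + 1 : ℝ) / (m + 1 + x))) atTop
      (𝓝 (Real.Gamma (x + 1))) := by
  rcases hx.eq_or_lt with rfl | hx
  · have : ∀ m : ℕ, (m + 1 : ℝ) / (m + 1 + 0) = 1 := fun m => by
      rw [add_zero]; exact div_self (by positivity)
    simp only [this, Finset.prod_const_one, Real.rpow_zero, mul_one, zero_add, Real.Gamma_one,
      tendsto_const_nhds]
  · rw [Real.Gamma_add_one hx.ne']
    -- The factor `x` cancels the `m = 0` term of the denominator in `GammaSeq`.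
    refine ((Real.GammaSeq_tendsto_Gamma x).const_mul x).congr fun M => ?_
    rw [Real.GammaSeq, Finset.prod_range_succ', Finset.prod_div_distrib,
      ← Finset.prod_range_add_one_eq_factorial]
    have : ∏ m ∈ Finset.range M, (x + ((m + 1 : ℕ) : ℝ)) = ∏ m ∈ Finset.range M, (m + 1 + x) :=
      Finset.prod_congr rfl fun m _ => by push_cast; ring
    rw [this]
    push_cast
    have h0 : ∏ m ∈ Finset.range M, ((m : ℝ) + 1 + x) ≠ 0 :=
      (Finset.prod_pos fun m _ => by positivity).ne'
    field_simp
    simp [mul_comm]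

theorem Finset.prod_range_mul_eq {M : Type*} [CommMonoid M] (f : ℕ → M) (K n : ℕ) :
    ∏ m ∈ Finset.range (K * n), f m = ∏ i ∈ Finset.range n, ∏ j ∈ Finset.range K, f (K * i + j) := by
  induction n with
  | zero => simp
  | succ n ih => rw [Nat.mul_succ, Finset.prod_range_add, ih, Finset.prod_range_succ]

/-- Euler's product along `M = K * n`, with `m = K * i + j` and each factor divided through by `K`.
-/
theorem tendsto_Gamma_nat_mul_add_one {K : ℕ} (hK : 0 < K) {s : ℝ} (hs : 0 ≤ s) :
    Tendsto (fun n : ℕ => ((K : ℝ) * n) ^ (K * s) *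
      ∏ i ∈ Finset.range n, ∏ j ∈ Finset.range K,
        ((i + (j + 1) / K : ℝ) / (i + (j + 1) / K + s))) atTop (𝓝 (Real.Gamma (K * s + 1))) := by
  have hK' : (0 : ℝ) < K := by exact_mod_cast hK
  refine ((tendsto_rpow_mul_prod_Gamma_add_one (x := K * s) (by positivity)).comp
    (tendsto_id.const_mul_atTop' hK)).congr fun n => ?_
  simp only [Function.comp_apply, id_eq, Finset.prod_range_mul_eq]
  push_cast
  congr 1
  refine Finset.prod_congr rfl fun i _ => Finset.prod_congr rfl fun j _ => ?_
  rw [div_eq_div_iff (by positivity) (by positivity)]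
  field_simp
  ring

theorem tendsto_Gamma_ratio {k : ℕ} (hk : 0 < k) {s : ℝ} (hs : 0 ≤ s) :
    Tendsto (fun n : ℕ => ∏ i ∈ Finset.range n, ∏ j ∈ Finset.range k,
        (((s + (i + (j + 1) / k)) / (s + (i + (j + 1) / (k + 1)))) *
          ((i + (j + 1) / (k + 1)) / (i + (j + 1) / k)) : ℝ)) atTop
      (𝓝 (Real.Gamma ((k + 1) * s + 1) / (Real.Gamma (s + 1) * Real.Gamma (k * s + 1)) /
        ((k + 1 : ℝ) ^ (k + 1) / (k : ℝ) ^ k) ^ s)) := by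
  have hk' : (0 : ℝ) < k := by exact_mod_cast hk
  have h1 := tendsto_Gamma_nat_mul_add_one (K := k + 1) (by omega) hs
  have h2 := tendsto_Gamma_nat_mul_add_one (K := 1) (by omega) hs
  have h3 := tendsto_Gamma_nat_mul_add_one hk hs
  simp only [Nat.cast_add, Nat.cast_one, one_mul] at h1 h2
  have hG1 := (Real.Gamma_pos_of_pos (by positivity : 0 < s + 1)).ne'
  have hG2 := (Real.Gamma_pos_of_pos (by positivity : 0 < k * s + 1)).ne'
  refine ((h1.div (h2.mul h3) (mul_ne_zero hG1 hG2)).div_const _).congr' ?_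
  filter_upwards [eventually_gt_atTop 0] with n hn
  have hn' : (0 : ℝ) < n := by exact_mod_cast hn
  -- The powers of `n` balance, leaving exactly `C ^ s`.
  have e1 : ((k + 1 : ℝ) * n) ^ ((k + 1) * s) =
      ((k + 1 : ℝ) ^ (k + 1) / (k : ℝ) ^ k) ^ s * (n ^ s * (k * n : ℝ) ^ (k * s)) := by
    rw [Real.rpow_mul (by positivity), Real.rpow_mul (by positivity),
      ← Real.mul_rpow (by positivity) (by positivity),
      ← Real.mul_rpow (by positivity) (by positivity)]
    congr 1
    rw [Real.rpow_natCast, show (k + 1 : ℝ) = ((k + 1 : ℕ) : ℝ) by push_cast; rfl,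
      Real.rpow_natCast]
    field_simp
    ring
  -- The term `j = k` on the left has `a = i + 1` and cancels the factor from `Γ(s+1)`; the others
  -- pair with those of `Γ(ks+1)`.
  have e2 : ∀ i : ℕ, ∏ j ∈ Finset.range (k + 1),
      ((i + (j + 1) / (k + 1) : ℝ) / (i + (j + 1) / (k + 1) + s)) =
      (∏ j ∈ Finset.range k,
        (((s + (i + (j + 1) / k)) / (s + (i + (j + 1) / (k + 1)))) *
          ((i + (j + 1) / (k + 1)) / (i + (j + 1) / k)) : ℝ)) *
      ((∏ j ∈ Finset.range 1, ((i + (j + 1) / 1 : ℝ) / (i + (j + 1) / 1 + s))) *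
        ∏ j ∈ Finset.range k, ((i + (j + 1) / k : ℝ) / (i + (j + 1) / k + s))) := by
    intro i
    rw [Finset.prod_range_succ, mul_comm (∏ j ∈ Finset.range 1, _), ← mul_assoc,
      ← Finset.prod_mul_distrib]
    congr 1
    · refine Finset.prod_congr rfl fun j _ => ?_
      rw [add_comm s, add_comm s]
      have : (i + (j + 1) / k + s : ℝ) ≠ 0 := by positivity
      have : (i + (j + 1) / k : ℝ) ≠ 0 := by positivity
      have : (i + (j + 1) / (k + 1) + s : ℝ) ≠ 0 := by positivity
      generalize (i + (j + 1) / k : ℝ) = b at *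
      generalize (i + (j + 1) / (k + 1) : ℝ) = a at *
      field_simp
    · simp [div_self (by positivity : (k + 1 : ℝ) ≠ 0)]
  simp only [Pi.div_apply]
  rw [e1, Finset.prod_congr rfl fun i _ => e2 i, Finset.prod_mul_distrib, Finset.prod_mul_distrib]
  have p1 : ∏ i ∈ Finset.range n, ∏ j ∈ Finset.range 1,
      ((i + (j + 1) / 1 : ℝ) / (i + (j + 1) / 1 + s)) ≠ 0 :=
    (Finset.prod_pos fun i _ => Finset.prod_pos fun j _ => by positivity).ne'
  have p2 : ∏ i ∈ Finset.range n, ∏ j ∈ Finset.range k,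
      ((i + (j + 1) / k : ℝ) / (i + (j + 1) / k + s)) ≠ 0 :=
    (Finset.prod_pos fun i _ => Finset.prod_pos fun j _ => by positivity).ne'
  have p3 : ((k + 1 : ℝ) ^ (k + 1) / (k : ℝ) ^ k) ^ s ≠ 0 := by positivity
  have p4 : (n : ℝ) ^ s ≠ 0 := by positivity
  have p5 : (k * n : ℝ) ^ (k * s) ≠ 0 := by positivity
  generalize ∏ i ∈ Finset.range n, ∏ j ∈ Finset.range 1,
      ((i + (j + 1) / 1 : ℝ) / (i + (j + 1) / 1 + s)) = A at *
  generalize ∏ i ∈ Finset.range n, ∏ j ∈ Finset.range k,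
      ((i + (j + 1) / k : ℝ) / (i + (j + 1) / k + s)) = B at *
  generalize ((k + 1 : ℝ) ^ (k + 1) / (k : ℝ) ^ k) ^ s = D at *
  generalize (n : ℝ) ^ s = E at *
  generalize (k * n : ℝ) ^ (k * s) = F at *
  generalize ∏ i ∈ Finset.range n, ∏ j ∈ Finset.range k,
        (((s + (i + (j + 1) / k)) / (s + (i + (j + 1) / (k + 1)))) *
          ((i + (j + 1) / (k + 1)) / (i + (j + 1) / k)) : ℝ) = P
  field_simp

theorem isMellin_Gamma_ratio_rpow {k : ℕ} (hk : 0 < k) {c : ℝ} (hc : 0 < c) :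
    IsMellin fun s => (Real.Gamma ((k + 1) * s + 1) /
      (Real.Gamma (s + 1) * Real.Gamma (k * s + 1)) /
        ((k + 1 : ℝ) ^ (k + 1) / (k : ℝ) ^ k) ^ s) ^ c := by
  have hk' : (0 : ℝ) < k := by exact_mod_cast hk
  refine IsMellin.of_tendsto (f := fun n s => ∏ i ∈ Finset.range n, ∏ j ∈ Finset.range k,
        (((s + (i + (j + 1) / k)) / (s + (i + (j + 1) / (k + 1)))) *
          ((i + (j + 1) / (k + 1)) / (i + (j + 1) / k)) : ℝ) ^ c) (fun n => ?_) fun s hs => ?_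
  · refine IsMellin.prod _ fun i _ => IsMellin.prod _ fun j _ =>
      isMellin_ratio_rpow (by positivity) ?_ hc
    gcongr
    linarith
  · refine ((tendsto_Gamma_ratio hk hs).rpow_const (Or.inr hc.le)).congr fun n => ?_
    rw [← Real.finsetProd_rpow _ _ fun i _ => Finset.prod_nonneg fun j _ => by positivity]
    refine Finset.prod_congr rfl fun i _ => ?_
    rw [← Real.finsetProd_rpow _ _ fun j _ => by positivity]

/-! ### Determinacy under geometric moment growth -/

namespace Stieltjes

theorem HasMoments.restrict_Ici {μ : Measure ℝ} {m : ℕ → ℝ} (h : HasMoments μ m) :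
    μ.restrict (Ici 0) = μ :=
  Measure.restrict_eq_self_of_ae_mem <| by
    rw [ae_iff]
    exact measure_mono_null (fun x hx => by simpa using hx) h.1

theorem HasMoments.isFiniteMeasure {μ : Measure ℝ} {m : ℕ → ℝ} (h : HasMoments μ m) :
    IsFiniteMeasure μ := by
  have := (h.2 0).1
  simp only [pow_zero, IntegrableOn, h.restrict_Ici] at this
  simpa [integrable_const_iff] using this

/-- If the moments grow at most geometrically, the measure has bounded support. -/
theorem HasMoments.ae_le {μ : Measure ℝ} {m : ℕ → ℝ} (h : HasMoments μ m) {R : ℝ} (hR : 0 < R)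
    (hm : ∀ n, m n ≤ R ^ n) : ∀ᵐ x ∂μ, x ≤ R := by
  have := h.isFiniteMeasure
  have key : ∀ R', R < R' → μ (Ici R') = 0 := by
    intro R' hR'
    have hR'0 : 0 < R' := hR.trans hR'
    -- Markov's inequality for `x ^ n`; then `n → ∞`.
    have hb : ∀ n : ℕ, μ.real (Ici R') ≤ (R / R') ^ n := by
      intro n
      rw [div_pow, le_div_iff₀ (by positivity), mul_comm]
      refine le_trans ?_ (hm n)
      rw [← (h.2 n).2]
      have hsub : Ici R' ⊆ Ici (0 : ℝ) := Ici_subset_Ici.2 hR'0.le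
      refine le_trans ?_ (setIntegral_mono_set (h.2 n).1
        (ae_restrict_of_forall_mem measurableSet_Ici fun x hx => pow_nonneg hx n)
        hsub.eventuallyLE)
      have := setIntegral_mono_on (f := fun _ => R' ^ n) (μ := μ) (s := Ici R')
        (by simp) ((h.2 n).1.mono_set hsub) measurableSet_Ici
        (fun x hx => pow_le_pow_left₀ hR'0.le hx n)
      simpa [mul_comm] using this
    have h0 : μ.real (Ici R') ≤ 0 :=
      ge_of_tendsto' (tendsto_pow_atTop_nhds_zero_of_lt_one (by positivity)
        ((div_lt_one hR'0).2 hR')) hb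
    exact (measureReal_eq_zero_iff).1 (le_antisymm h0 measureReal_nonneg)
  rw [ae_iff]
  have : {x : ℝ | ¬ x ≤ R} ⊆ ⋃ n : ℕ, Ici (R + 1 / (n + 1)) := by
    intro x hx
    obtain ⟨n, hn⟩ := exists_nat_one_div_lt (sub_pos.2 (not_le.1 hx))
    exact mem_iUnion.2 ⟨n, by simp only [mem_Ici]; linarith⟩
  refine measure_mono_null this (measure_iUnion_null fun n => key _ ?_)
  have : (0 : ℝ) < 1 / (n + 1) := by positivity
  linarith

theorem HasMoments.ae_mem_Icc {μ : Measure ℝ} {m : ℕ → ℝ} (h : HasMoments μ m) {R : ℝ}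
    (hR : 0 < R) (hm : ∀ n, m n ≤ R ^ n) : ∀ᵐ x ∂μ, x ∈ Icc 0 R := by
  have h0 : ∀ᵐ x ∂μ, 0 ≤ x := by
    rw [ae_iff]
    exact measure_mono_null (fun x hx => by simpa using hx) h.1
  filter_upwards [h0, h.ae_le hR hm] with x h1 h2 using ⟨h1, h2⟩

theorem HasMoments.integral_polynomial {μ : Measure ℝ} {m : ℕ → ℝ} (h : HasMoments μ m)
    (p : Polynomial ℝ) :
    Integrable (fun x => p.eval x) μ ∧ ∫ x, p.eval x ∂μ = p.sum fun n a => a * m n := by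
  have hi : ∀ n, Integrable (fun x : ℝ => x ^ n) μ := fun n => by
    have := (h.2 n).1
    rwa [IntegrableOn, h.restrict_Ici] at this
  have hv : ∀ n, ∫ x : ℝ, x ^ n ∂μ = m n := fun n => by
    have := (h.2 n).2
    rwa [h.restrict_Ici] at this
  simp only [Polynomial.eval_eq_sum, Polynomial.sum]
  refine ⟨integrable_finsetSum _ fun n _ => (hi n).const_mul _, ?_⟩
  rw [integral_finsetSum _ fun n _ => (hi n).const_mul _]
  simp only [integral_const_mul, hv]

/-- Two measures with the same, at most geometrically growing, moments agree. -/
theorem HasMoments.unique {μ ν : Measure ℝ} {m : ℕ → ℝ} (hμ : HasMoments μ m)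
    (hν : HasMoments ν m) {R : ℝ} (hR : 0 < R) (hm : ∀ n, m n ≤ R ^ n) : μ = ν := by
  have := hμ.isFiniteMeasure
  have := hν.isFiniteMeasure
  refine ext_of_forall_integral_eq_of_IsFiniteMeasure fun f => ?_
  -- Both measures live on `[0, R]`, where Weierstrass approximation reduces `f` to polynomials,
  -- whose integrals depend only on `m`.
  have approx : ∀ {κ : Measure ℝ} [IsFiniteMeasure κ], HasMoments κ m → ∀ (p : Polynomial ℝ) (ε : ℝ),
      0 ≤ ε → (∀ x ∈ Icc 0 R, |p.eval x - f x| ≤ ε) →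
      |∫ x, p.eval x ∂κ - ∫ x, f x ∂κ| ≤ ε * κ.real univ := by
    intro κ _ hκ p ε _ hp
    rw [← integral_sub (hκ.integral_polynomial p).1 (f.integrable κ), ← Real.norm_eq_abs]
    exact norm_integral_le_of_norm_le_const
      ((hκ.ae_mem_Icc hR hm).mono fun x hx => hp x hx)
  have hle : ∀ ε : ℝ, 0 < ε →
      |∫ x, f x ∂μ - ∫ x, f x ∂ν| ≤ ε * (μ.real univ + ν.real univ) := by
    intro ε hε
    obtain ⟨p, hp⟩ := exists_polynomial_near_of_continuousOn 0 R f f.continuous.continuousOn ε hε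
    have h1 := approx hμ p ε hε.le fun x hx => (hp x hx).le
    have h2 := approx hν p ε hε.le fun x hx => (hp x hx).le
    rw [(hμ.integral_polynomial p).2] at h1
    rw [(hν.integral_polynomial p).2] at h2
    rw [mul_add]
    rw [abs_le] at *
    constructor <;> linarith [h1.1, h1.2, h2.1, h2.2]
  have hlim : Tendsto (fun ε : ℝ => ε * (μ.real univ + ν.real univ)) (𝓝[>] 0) (𝓝 0) := by
    have : Tendsto (fun ε : ℝ => ε * (μ.real univ + ν.real univ)) (𝓝 0)
        (𝓝 (0 * (μ.real univ + ν.real univ))) := by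
      apply Continuous.tendsto; fun_prop
    rw [zero_mul] at this
    exact this.mono_left nhdsWithin_le_nhds
  have h0 := ge_of_tendsto hlim (eventually_mem_nhdsWithin.mono fun ε hε => hle ε hε)
  exact sub_eq_zero.1 (abs_eq_zero.1 (le_antisymm h0 (abs_nonneg _)))

end Stieltjes

/-! ### The measure for powers of the binomial coefficients -/

theorem exists_measure_mellin_Gamma_ratio {k : ℕ} (hk : 0 < k) {c : ℝ} (hc : 0 < c) :
    ∃ μ : Measure ℝ, μ (Iio 0) = 0 ∧ ∀ s : ℝ, 0 ≤ s →
      IntegrableOn (fun t : ℝ => t ^ s) (Ici 0) μ ∧ ∫ t in Ici 0, t ^ s ∂μ =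
        (Real.Gamma ((k + 1) * s + 1) / (Real.Gamma (s + 1) * Real.Gamma (k * s + 1))) ^ c := by
  have hk' : (0 : ℝ) < k := by exact_mod_cast hk
  obtain ⟨ν, hν⟩ := isMellin_Gamma_ratio_rpow hk hc
  set C : ℝ := (k + 1 : ℝ) ^ (k + 1) / (k : ℝ) ^ k
  have hC : 0 < C := by positivity
  have hCc : 0 < C ^ c := by positivity
  -- Dilation by `C ^ c` multiplies the transform by `(C ^ s) ^ c`, undoing the normalisation.
  let φ : unitInterval → ℝ := fun x => C ^ c * x
  have hφ : Measurable φ := by fun_prop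
  have hφ0 : ∀ x, 0 ≤ φ x := fun x => mul_nonneg hCc.le x.2.1
  have h0 : (ν : Measure unitInterval).map φ (Iio 0) = 0 := by
    rw [Measure.map_apply hφ measurableSet_Iio]
    convert! measure_empty (μ := (ν : Measure unitInterval))
    ext x
    simpa using hφ0 x
  have hres : ((ν : Measure unitInterval).map φ).restrict (Ici 0) =
      (ν : Measure unitInterval).map φ :=
    Measure.restrict_eq_self_of_ae_mem <| by
      rw [ae_iff]
      exact measure_mono_null (fun x hx => by simpa using hx) h0
  refine ⟨_, h0, fun s hs => ?_⟩
  have hms : Measurable fun t : ℝ => t ^ s := by fun_prop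
  have hpow : ∀ x, φ x ^ s = (C ^ c) ^ s * (x : ℝ) ^ s := fun x =>
    Real.mul_rpow hCc.le x.2.1
  rw [IntegrableOn, hres, integrable_map_measure hms.aestronglyMeasurable hφ.aemeasurable,
    integral_map hφ.aemeasurable hms.aestronglyMeasurable]
  simp only [Function.comp_def, hpow]
  refine ⟨(integrable_unitPow _ hs).const_mul _, ?_⟩
  have hG : 0 ≤ Real.Gamma ((k + 1) * s + 1) / (Real.Gamma (s + 1) * Real.Gamma (k * s + 1)) :=
    div_nonneg (Real.Gamma_nonneg_of_nonneg (by positivity))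
      (mul_nonneg (Real.Gamma_nonneg_of_nonneg (by positivity))
        (Real.Gamma_nonneg_of_nonneg (by positivity)))
  rw [integral_const_mul, hν s hs, ← Real.rpow_mul hC.le, mul_comm c, Real.rpow_mul hC.le,
    ← Real.mul_rpow (by positivity) (by positivity), mul_div_cancel₀ _ (by positivity)]

theorem Gamma_ratio_natCast (k n : ℕ) :
    Real.Gamma ((k + 1) * n + 1) / (Real.Gamma (n + 1) * Real.Gamma (k * n + 1)) =
      (((k + 1) * n).choose n : ℝ) := by
  have h1 : ((k + 1) * n + 1 : ℝ) = (((k + 1) * n : ℕ) : ℝ) + 1 := by push_cast; rfl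
  have h2 : (k * n + 1 : ℝ) = ((k * n : ℕ) : ℝ) + 1 := by push_cast; rfl
  rw [h1, h2, Real.Gamma_nat_eq_factorial, Real.Gamma_nat_eq_factorial,
    Real.Gamma_nat_eq_factorial, Nat.cast_choose ℝ (Nat.le_mul_of_pos_left n k.succ_pos),
    show (k + 1) * n - n = k * n by rw [Nat.add_mul, one_mul, Nat.add_sub_cancel]]

/-- Any geometric bound suffices for determinacy, so the crude `2 ^ ((k+1) * n)` is enough. -/
theorem choose_rpow_le (k n : ℕ) {c : ℝ} (hc : 0 < c) :
    (((k + 1) * n).choose n : ℝ) ^ c ≤ (((2 : ℝ) ^ (k + 1)) ^ c) ^ n := by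
  have h : (((k + 1) * n).choose n : ℝ) ≤ ((2 : ℝ) ^ (k + 1)) ^ n := by
    rw [← pow_mul]
    exact_mod_cast Nat.choose_le_two_pow _ _
  exact (Real.rpow_le_rpow (Nat.cast_nonneg _) h hc.le).trans_eq
    (Real.rpow_pow_comm (by positivity) c n).symm

theorem exists_hasMoments_choose_rpow {k : ℕ} (hk : 0 < k) {c : ℝ} (hc : 0 < c) :
    ∃ μ : Measure ℝ, Stieltjes.HasMoments μ (fun n => (((k + 1) * n).choose n : ℝ) ^ c) ∧
      ∀ s : ℝ, 0 ≤ s → IntegrableOn (fun t : ℝ => t ^ s) (Ici 0) μ ∧ ∫ t in Ici 0, t ^ s ∂μ =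
        (Real.Gamma ((k + 1) * s + 1) / (Real.Gamma (s + 1) * Real.Gamma (k * s + 1))) ^ c := by
  obtain ⟨μ, h0, hμ⟩ := exists_measure_mellin_Gamma_ratio hk hc
  refine ⟨μ, ⟨h0, fun n => ?_⟩, hμ⟩
  simpa only [Real.rpow_natCast, Gamma_ratio_natCast] using hμ n n.cast_nonneg

theorem theorem6 (k : ℕ) (hk : 2 ≤ k) :
    Stieltjes.IsInfDivMomentSeq (fun n => (((k + 1) * n).choose n : ℝ)) ∧
    (∀ c : ℝ, 0 < c → Stieltjes.IsDet (fun n => (((k + 1) * n).choose n : ℝ) ^ c)) ∧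
    (∀ c : ℝ, 0 < c → ∀ μ : Measure ℝ,
      Stieltjes.HasMoments μ (fun n => (((k + 1) * n).choose n : ℝ) ^ c) →
      ∀ s : ℝ, 0 ≤ s →
        IntegrableOn (fun t : ℝ => t ^ s) (Ici 0) μ ∧
        ∫ t in Ici 0, t ^ s ∂μ =
          (Real.Gamma ((k + 1) * s + 1) / (Real.Gamma (s + 1) * Real.Gamma (k * s + 1))) ^ c) := by
  have hk0 : 0 < k := by omega
  have huniq : ∀ c : ℝ, 0 < c → ∀ μ ν : Measure ℝ,
      Stieltjes.HasMoments μ (fun n => (((k + 1) * n).choose n : ℝ) ^ c) →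
      Stieltjes.HasMoments ν (fun n => (((k + 1) * n).choose n : ℝ) ^ c) → μ = ν :=
    fun c hc μ ν hμ hν => hμ.unique hν (by positivity) fun n => choose_rpow_le k n hc
  refine ⟨fun c hc => ?_, fun c hc => ?_, fun c hc μ hμ => ?_⟩
  · obtain ⟨μ, hμ, -⟩ := exists_hasMoments_choose_rpow hk0 hc
    exact ⟨μ, hμ⟩
  · obtain ⟨μ, hμ, -⟩ := exists_hasMoments_choose_rpow hk0 hc
    exact ⟨μ, hμ, fun ν hν => huniq c hc ν μ hν hμ⟩
  · obtain ⟨ν, hν, h⟩ := exists_hasMoments_choose_rpow hk0 hc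
    rwa [huniq c hc μ ν hμ hν]
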